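/- Let $r\ge 0$ be an integer and let $\mathcal{H}_r$ be the Hirzebruch surface over $\mathbb{C}$, the smooth complete toric surface whose fan has the rays $u_1=-e_1+re_2,\ u_2=e_2,\ u_3=e_1,\ u_4=-e_2$ and the maximal cones spanned by $\{u_1,u_2\},\{u_2,u_3\},\{u_3,u_4\},\{u_4,u_1\}$. Let $D_i$ be the torus-invariant divisor of $u_i$. Let $S=\mathbb{C}[x_1,x_2,x_3,x_4]$ be the Cox ring, graded by $\operatorname{Pic}(\mathcal{H}_r)=\mathbb{Z}D_1\oplus\mathbb{Z}D_2$ with $\deg x_1=\deg x_3=D_1$, $\deg x_2=D_2$, $\deg x_4=rD_1+D_2$, so that $S_\beta=\Gamma(\mathcal{H}_r,\mathcal{O}(\beta))$. Thus $\mathcal{H}_r$ is the quotient of $\mathbb{C}^4\setminus V(x_3x_4,x_1x_4,x_1x_2,x_2x_3)$ by the group $\{(\lambda,\mu,\lambda,\lambda^r\mu):\lambda,\mu\in\mathbb{C}^*\}$. Let $\beta=aD_1+bD_2$ be an ample class, i.e. $b>0$ and $a>rb$, and let $0\ne f\in S_\beta$ be nondegenerate: for every cone $\tau$ of the fan, the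 intersection of $\{f=0\}$ with the torus orbit $O(\tau)$ is smooth of codimension $1$ in $O(\tau)$ (or empty). Put $$J_0(f)=\Big\langle x_i\frac{\partial f}{\partial x_i}: 1\le i\le 4\Big\rangle\subset S,\qquad J_1(f)=\big(J_0(f):x_1x_2x_3x_4\big),\qquad J_1(f)_\beta=J_1(f)\cap S_\beta .$$ Let $Z=\{f=0\}\subset\mathcal{H}_r$, and let $L$ be the image of $J_1(f)_\beta$ under restriction of sections to $Z$. Then the linear system $L$ is base point free: for every $p\in Z$ there is $s\in L$ with $s(p)\neq 0$. The induced map $\varphi: Z\to\mathbb{P}(L^*)$, $p\mapsto[s\mapsto s(p)]$, is a morphism, and it is birational onto its image: there are a dense open $U\subset Z$ and a dense open $V\subset\varphi(Z)$ such that $\varphi$ restricts to an isomorphism $U\to V$. -/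

import Mathlib

open scoped Topology

/-! Classical varieties: sets of closed points with their regular functions. -/

/-- A set of points together with its basic regular functions: a pair `(D, q)` stands for a
fraction `q = F / G` of two forms of equal degree, and `D` is the locus `G ≠ 0` on which it is
defined (the values of `q` outside `D` carry no meaning). -/
class FractionSpace (X : Type*) where
  fractions : Set (Set X × (X → ℂ))

namespace FractionSpace

/-- The Zariski topology: its basic open sets are the loci `G ≠ 0`. -/
def zariski (X : Type*) [FractionSpace X] : TopologicalSpace X :=
  TopologicalSpace.generateFrom {D | ∃ q, (D, q) ∈ fractions (X := X)}

/-- The restriction of `h` to `O` is a regular function: locally it is a fraction `F / G`. -/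
def RegularOn {X : Type*} [FractionSpace X] (O : Set X) (h : X → ℂ) : Prop :=
  ∀ p ∈ O, ∃ D q, (D, q) ∈ fractions (X := X) ∧ p ∈ D ∧ ∀ x ∈ O ∩ D, h x = q x

/-- A subset of a variety carries the restrictions of the fractions of the ambient variety. -/
instance subsetSpace {X : Type*} [FractionSpace X] (A : Set X) : FractionSpace A where
  fractions := {s | ∃ D q, (D, q) ∈ fractions (X := X) ∧
    s = (Subtype.val ⁻¹' D, fun x => q x.1)}

/-- A morphism is a Zariski continuous map that pulls regular functions on open sets back to
regular functions. -/
def IsMorphism {X Y : Type*} [FractionSpace X] [FractionSpace Y] (φ : X → Y) : Prop :=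
  Continuous[zariski X, zariski Y] φ ∧
    ∀ (O : Set Y) (h : Y → ℂ), IsOpen[zariski Y] O → RegularOn O h →
      RegularOn (φ ⁻¹' O) (h ∘ φ)

/-- `φ` is birational onto its image: it restricts to an isomorphism between a dense open subset
of its source and a dense open subset of its image. -/
def IsBirationalOntoImage {X Y : Type*} [FractionSpace X] [FractionSpace Y] (φ : X → Y) : Prop :=
  ∃ (U : Set X) (V : Set (Set.range φ)),
    IsOpen[zariski X] U ∧ @Dense X (zariski X) U ∧
    IsOpen[zariski (Set.range φ)] V ∧ @Dense (Set.range φ) (zariski (Set.range φ)) V ∧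
    ∃ e : U ≃ V, IsMorphism e ∧ IsMorphism e.symm ∧ ∀ x : U, (e x).1.1 = φ x.1

/-- The projective space of lines in `W`. Its forms of degree `d` are the homogeneous polynomials
of degree `d` in linear forms on `W`. -/
instance projectiveSpace (W : Type*) [AddCommGroup W] [Module ℂ W] :
    FractionSpace (Projectivization ℂ W) where
  fractions := {s | ∃ (d : ℕ) (F G : MvPolynomial (Module.Dual ℂ W) ℂ),
    F.IsHomogeneous d ∧ G.IsHomogeneous d ∧
    ∀ (w : W) (hw : w ≠ 0),
      (Projectivization.mk ℂ w hw ∈ s.1 ↔ MvPolynomial.eval (fun l => l w) G ≠ 0) ∧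
      s.2 (Projectivization.mk ℂ w hw) =
        MvPolynomial.eval (fun l => l w) F / MvPolynomial.eval (fun l => l w) G}

end FractionSpace

/-! The Hirzebruch surface `H_r`, with ray generators
`u₁ = -e₁ + r e₂`, `u₂ = e₂`, `u₃ = e₁`, `u₄ = -e₂`; the ray `uᵢ` has index `i - 1 : Fin 4`. -/

namespace Hirzebruch

/-- The Cox ring `ℂ[x₁, x₂, x₃, x₄]`. -/
abbrev CoxRing : Type := MvPolynomial (Fin 4) ℂ

/-- The classes of `D₁, D₂, D₃, D₄` in the Picard group, in the basis `D₁, D₂`. -/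
def coxDegree (r : ℕ) : Fin 4 → ℤ × ℤ := ![(1, 0), (0, 1), (1, 0), ((r : ℤ), 1)]

/-- The graded piece `S_β` of the Cox ring, that is, the space of sections of the class `β`. -/
noncomputable def sections (r : ℕ) (β : ℤ × ℤ) : Submodule ℂ CoxRing :=
  MvPolynomial.weightedHomogeneousSubmodule ℂ (coxDegree r) β

/-- The rays of the four two-dimensional cones of the fan. -/
def maximalCones : Set (Finset (Fin 4)) := {{0, 1}, {1, 2}, {2, 3}, {3, 0}}

/-- All cones of the fan (each one given by its rays): the faces of the maximal ones. -/
def cones : Set (Finset (Fin 4)) := {τ | ∃ σ ∈ maximalCones, τ ⊆ σ}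

/-- The points of `ℂ⁴` outside the exceptional set `V(x₃x₄, x₁x₄, x₁x₂, x₂x₃)`. -/
def CoxPoint : Type := {x : Fin 4 → ℂ // ∃ σ ∈ maximalCones, ∀ i, i ∉ σ → x i ≠ 0}

/-- The element `(s, t, s, s ^ r * t)` of the group `G ≅ (ℂˣ)²`. -/
def torusElement (r : ℕ) (s t : ℂˣ) : Fin 4 → ℂˣ := ![s, t, s, s ^ r * t]

/-- Two points are equivalent when they lie in the same orbit of `G`. -/
def orbitSetoid (r : ℕ) : Setoid CoxPoint where
  r x y := ∃ s t : ℂˣ, ∀ i, y.1 i = torusElement r s t i * x.1 i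
  iseqv :=
    { refl := fun x => ⟨1, 1, fun i => by fin_cases i <;> simp [torusElement]⟩
      symm := by
        rintro x y ⟨s, t, h⟩
        refine ⟨s⁻¹, t⁻¹, fun i => ?_⟩
        rw [h i]
        fin_cases i <;> simp [torusElement] <;> field_simp
      trans := by
        rintro x y z ⟨s, t, h⟩ ⟨s', t', h'⟩
        refine ⟨s' * s, t' * t, fun i => ?_⟩
        rw [h' i, h i]
        fin_cases i <;> simp [torusElement] <;> ring }

/-- The surface `H_r = (ℂ⁴ - V(x₃x₄, x₁x₄, x₁x₂, x₂x₃)) / G`. -/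
def Surface (r : ℕ) : Type := Quotient (orbitSetoid r)

/-- The point of `H_r` with the given homogeneous coordinates. -/
def toSurface (r : ℕ) (x : CoxPoint) : Surface r := Quotient.mk (orbitSetoid r) x

/-- Rational functions on `H_r` are fractions of Cox polynomials of the same class. -/
instance surfaceSpace (r : ℕ) : FractionSpace (Surface r) where
  fractions := {u | ∃ (α : ℤ × ℤ) (F G : CoxRing), F ∈ sections r α ∧ G ∈ sections r α ∧
    ∀ x : CoxPoint, (toSurface r x ∈ u.1 ↔ MvPolynomial.eval x.1 G ≠ 0) ∧
      u.2 (toSurface r x) = MvPolynomial.eval x.1 F / MvPolynomial.eval x.1 G}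

/-- The zero locus `Z = {f = 0}` on `H_r`. -/
def curve (r : ℕ) (f : CoxRing) : Set (Surface r) :=
  {P | ∀ x : CoxPoint, toSurface r x = P → MvPolynomial.eval x.1 f = 0}

/-- Nondegeneracy of a section: for every cone `τ`, the intersection of `{f = 0}` with the torus
orbit `O(τ)` is smooth of codimension one in `O(τ)` (or empty). The orbit `O(τ)` is the quotient
by the freely acting group `G` of the torus of all `x` with `x i = 0` exactly for `i ∈ τ`, which
has the coordinates `x i`, `i ∉ τ`; smoothness is the Jacobian criterion in these coordinates. -/
def Nondegenerate (f : CoxRing) : Prop :=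
  f ≠ 0 ∧ ∀ τ ∈ cones, ∀ x : CoxPoint, (∀ i, x.1 i = 0 ↔ i ∈ τ) →
    MvPolynomial.eval x.1 f = 0 → ∃ i, i ∉ τ ∧ MvPolynomial.eval x.1 (MvPolynomial.pderiv i f) ≠ 0

/-- The ideal `J₀(f)` generated by all `xᵢ ∂f/∂xᵢ`. -/
noncomputable def J₀ (f : CoxRing) : Ideal CoxRing :=
  Ideal.span (Set.range fun i => MvPolynomial.X i * MvPolynomial.pderiv i f)

/-- The ideal quotient `J₁(f) = J₀(f) : ⟨x₁x₂x₃x₄⟩`. -/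
noncomputable def J₁ (f : CoxRing) : Ideal CoxRing :=
  (J₀ f).colon (Ideal.span {∏ i, (MvPolynomial.X i : CoxRing)} : Ideal CoxRing)

/-- The graded piece `J₁(f)_β = J₁(f) ∩ S_β`. -/
noncomputable def J₁piece (r : ℕ) (f : CoxRing) (β : ℤ × ℤ) : Submodule ℂ CoxRing :=
  (J₁ f).restrictScalars ℂ ⊓ sections r β

/-- The cone over the curve: all homogeneous coordinates of its points. -/
def Cone (r : ℕ) (f : CoxRing) : Type := {x : CoxPoint // toSurface r x ∈ curve r f}

/-- Restriction of sections to the curve. The result is viewed as a function of the homogeneous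
coordinates of points of the curve. -/
noncomputable def restrict (r : ℕ) (f : CoxRing) : CoxRing →ₗ[ℂ] (Cone r f → ℂ) where
  toFun g := fun x => MvPolynomial.eval x.1.1 g
  map_add' g h := by ext x; simp
  map_smul' c g := by ext x; simp

/-- The linear system `J₁(f)_β` restricted to the curve `{f = 0}`. -/
noncomputable def restrictedSystem (r : ℕ) (f : CoxRing) (β : ℤ × ℤ) :
    Submodule ℂ (Cone r f → ℂ) :=
  (J₁piece r f β).map (restrict r f)

/-- Evaluation of the restricted system at a point of the cone over the curve. -/
def evalAt (r : ℕ) (f : CoxRing) (β : ℤ × ℤ) (x : Cone r f) :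
    Module.Dual ℂ (restrictedSystem r f β) where
  toFun s := s.1 x
  map_add' _ _ := rfl
  map_smul' _ _ := rfl

/-- Base point freeness: at every point of the curve some member of the system is nonzero. -/
def BasePointFree (r : ℕ) (f : CoxRing) (β : ℤ × ℤ) : Prop :=
  ∀ x : Cone r f, ∃ s ∈ restrictedSystem r f β, s x ≠ 0

theorem evalAt_ne_zero {r : ℕ} {f : CoxRing} {β : ℤ × ℤ} (h : BasePointFree r f β)
    (x : Cone r f) : evalAt r f β x ≠ 0 := by
  obtain ⟨s, hs, hx⟩ := h x
  intro h0
  exact hx (LinearMap.congr_fun h0 ⟨s, hs⟩)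

/-- Homogeneous coordinates of a point of the curve. -/
noncomputable def lift {r : ℕ} {f : CoxRing} (P : curve r f) : Cone r f :=
  ⟨Quotient.out P.1, by
    have h : toSurface r (Quotient.out P.1) = P.1 := Quotient.out_eq P.1
    rw [h]; exact P.2⟩

/-- The map induced by the restricted system `L`: it sends `P` to the point
`[s ↦ s(P)]` of the projective space of lines in the dual space of `L`. -/
noncomputable def inducedMap {r : ℕ} {f : CoxRing} {β : ℤ × ℤ} (h : BasePointFree r f β)
    (P : curve r f) : Projectivization ℂ (Module.Dual ℂ (restrictedSystem r f β)) :=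
  Projectivization.mk ℂ (evalAt r f β (lift P)) (evalAt_ne_zero h (lift P))

/-- Elements of `S_β` are semi-invariants of `G`. -/
theorem eval_torus {r : ℕ} {β : ℤ × ℤ} {g : CoxRing} (hg : g ∈ sections r β) (s t : ℂˣ)
    (x : Fin 4 → ℂ) :
    MvPolynomial.eval (fun i => (torusElement r s t i : ℂ) * x i) g =
      ((s ^ β.1 * t ^ β.2 : ℂˣ) : ℂ) * MvPolynomial.eval x g := by
  rw [MvPolynomial.eval_eq', MvPolynomial.eval_eq', Finset.mul_sum]
  refine Finset.sum_congr rfl fun d hd => ?_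
  have hw : Finsupp.weight (coxDegree r) d = β := hg (MvPolynomial.mem_support_iff.mp hd)
  rw [Finsupp.weight_apply, Finsupp.sum_fintype _ _ (by simp)] at hw
  have h1 : β.1 = d 0 + d 2 + r * d 3 := by
    rw [← hw]; simp [Fin.sum_univ_four, coxDegree]; ring
  have h2 : β.2 = d 1 + d 3 := by
    rw [← hw]; simp [Fin.sum_univ_four, coxDegree]
  have e1 : s ^ β.1 = s ^ (d 0 + d 2 + r * d 3) := by rw [h1]; exact_mod_cast rfl
  have e2 : t ^ β.2 = t ^ (d 1 + d 3) := by rw [h2]; exact_mod_cast rfl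
  rw [e1, e2]
  simp [Fin.prod_univ_four, torusElement]
  ring

/-- The induced map does not depend on the choice of homogeneous coordinates. -/
theorem inducedMap_eq {r : ℕ} {f : CoxRing} {β : ℤ × ℤ} (h : BasePointFree r f β)
    (P : curve r f) (x : Cone r f) (hx : toSurface r x.1 = P.1) :
    inducedMap h P = Projectivization.mk ℂ (evalAt r f β x) (evalAt_ne_zero h x) := by
  have h1 : toSurface r x.1 = toSurface r (lift P).1 :=
    hx.trans (Quotient.out_eq P.1).symm
  obtain ⟨s, t, hst⟩ := Quotient.exact h1
  refine (Projectivization.mk_eq_mk_iff ℂ _ _ _ _).mpr ⟨s ^ β.1 * t ^ β.2, ?_⟩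
  ext ⟨v, hv⟩
  obtain ⟨g, hg, rfl⟩ := hv
  have h2 := eval_torus hg.2 s t x.1.1
  have h3 : (lift P).1.1 = fun i => (torusElement r s t i : ℂ) * x.1.1 i := funext hst
  change ((s ^ β.1 * t ^ β.2 : ℂˣ) : ℂ) * MvPolynomial.eval x.1.1 g =
    MvPolynomial.eval (lift P).1.1 g
  rw [h3, h2]

end Hirzebruch

/-!
The linear system contains the logarithmic derivatives `xᵢ ∂f/∂xᵢ`, and nondegeneracy says exactly
that these have no common zero on the surface (`Nondegenerate.no_common_zero`). Hence the system is
base point free. It is finite-dimensional, so forms on the projective space of its dual pull back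
to sections of multiples of `β`, and the induced map is a morphism (`isMorphism_inducedMap`).

For birationality, note that `J₁(f)_β` also contains `x₃ ∂f/∂x₁` and `x₂ x₃ʳ ∂f/∂x₄`, the
derivatives of `f` along root automorphisms of the surface. The quotients of `x₁ ∂f/∂x₁` by
`x₃ ∂f/∂x₁` and of `x₄ ∂f/∂x₄` by `x₂ x₃ʳ ∂f/∂x₄` are the affine coordinates `x₁/x₃` and
`x₄/(x₂x₃ʳ)`. So the induced map has an inverse given by fractions wherever the denominator
`x₃ ∂f/∂x₁ · x₂ x₃ʳ ∂f/∂x₄` does not vanish (`exists_inverse_fraction`).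

It remains to see that this locus is dense in the curve. By the Nullstellensatz
(`eval_eq_zero_of_isRelPrime`) this holds when `f` is coprime to `x₂`, `x₃`, `∂f/∂x₁` and
`∂f/∂x₄`. The variables do not divide `f` because `f` is nonzero at the torus fixed points. A prime
`P` dividing `f` and `∂f/∂xᵢ` is a simple factor of `f`, so it divides `∂P/∂xᵢ` and `P`
is constant in the direction of `xᵢ`. Therefore the closure of a line parallel to the `xᵢ`-axis
lies in the curve, and `xᵢ ∂f/∂xᵢ` vanishes on it. By the Euler relations only one other
logarithmic derivative remains to be considered, and it restricts to a binary form of degree `a`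
or `b`. This degree is positive, so the form has a zero on the line or at infinity, contradicting
nondegeneracy (`isRelPrime_pderiv_zero`, `isRelPrime_pderiv_three`).

The variable `x_(i+1)` of this text has index `i : Fin 4` in the code.
-/

open MvPolynomial

namespace Hirzebruch

/-! ### Graded pieces of the Cox ring -/

theorem weight_coxDegree (r : ℕ) (d : Fin 4 →₀ ℕ) :
    Finsupp.weight (coxDegree r) d = ((d 0 + d 2 + r * d 3 : ℤ), (d 1 + d 3 : ℤ)) := by
  rw [Finsupp.weight_apply, Finsupp.sum_fintype _ _ (by simp)]
  ext
  · simp [Fin.sum_univ_four, coxDegree]; ring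
  · simp [Fin.sum_univ_four, coxDegree]

theorem mul_mem_sections {r : ℕ} {α β : ℤ × ℤ} {g h : CoxRing} (hg : g ∈ sections r α)
    (hh : h ∈ sections r β) : g * h ∈ sections r (α + β) :=
  IsWeightedHomogeneous.mul hg hh

theorem X_mem_sections (r : ℕ) (i : Fin 4) : (X i : CoxRing) ∈ sections r (coxDegree r i) :=
  isWeightedHomogeneous_X ℂ _ i

theorem pderiv_mem_sections {r : ℕ} {β : ℤ × ℤ} {g : CoxRing} (hg : g ∈ sections r β)
    (i : Fin 4) : pderiv i g ∈ sections r (β - coxDegree r i) :=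
  IsWeightedHomogeneous.pderiv hg (sub_add_cancel _ _)

theorem X_mul_pderiv_mem_sections {r : ℕ} {β : ℤ × ℤ} {g : CoxRing} (hg : g ∈ sections r β)
    (i : Fin 4) : X i * pderiv i g ∈ sections r β := by
  have := mul_mem_sections (X_mem_sections r i) (pderiv_mem_sections hg i)
  rwa [add_sub_cancel] at this

instance sections_finiteDimensional (r : ℕ) (β : ℤ × ℤ) :
    FiniteDimensional ℂ (sections r β) := by
  have hfin : {d : Fin 4 →₀ ℕ | Finsupp.weight (coxDegree r) d = β}.Finite := by
    refine (Set.finite_Iic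
      (Finsupp.equivFunOnFinite.symm fun _ => β.1.toNat + β.2.toNat)).subset fun d hd => ?_
    have hd' : Finsupp.weight (coxDegree r) d = β := hd
    rw [weight_coxDegree] at hd'
    have h1 := congrArg Prod.fst hd'
    have h2 := congrArg Prod.snd hd'
    simp only at h1 h2
    have h3 : (0 : ℤ) ≤ (r : ℤ) * d 3 := by positivity
    intro i
    simp only [Finsupp.equivFunOnFinite_symm_apply_apply]
    fin_cases i <;> simp <;> omega
  have := hfin.to_subtype
  rw [sections, weightedHomogeneousSubmodule_eq_finsupp_supported,
    AddMonoidAlgebra.supported_eq_span_single]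
  exact FiniteDimensional.span_of_finite ℂ (hfin.image _)

/-! ### Euler relations and common zeros of the logarithmic derivatives -/

theorem euler_fst {r a b : ℕ} {f : CoxRing} (hf : f ∈ sections r (a, b)) (x : Fin 4 → ℂ) :
    x 0 * eval x (pderiv 0 f) + x 2 * eval x (pderiv 2 f) + r * (x 3 * eval x (pderiv 3 f)) =
      a * eval x f := by
  have h : f.IsWeightedHomogeneous (![1, 0, 1, r] : Fin 4 → ℕ) a := by
    intro d hd
    have := congrArg Prod.fst ((weight_coxDegree r d).symm.trans (hf hd))
    simp only at this
    rw [Finsupp.weight_apply, Finsupp.sum_fintype _ _ (by simp)]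
    simp [Fin.sum_univ_four]
    zify
    linarith
  have := congrArg (eval x) h.sum_weight_X_mul_pderiv
  simp [Fin.sum_univ_four] at this
  linear_combination this

theorem euler_snd {r a b : ℕ} {f : CoxRing} (hf : f ∈ sections r (a, b)) (x : Fin 4 → ℂ) :
    x 1 * eval x (pderiv 1 f) + x 3 * eval x (pderiv 3 f) = b * eval x f := by
  have h : f.IsWeightedHomogeneous (![0, 1, 0, 1] : Fin 4 → ℕ) b := by
    intro d hd
    have := congrArg Prod.snd ((weight_coxDegree r d).symm.trans (hf hd))
    simp only at this
    rw [Finsupp.weight_apply, Finsupp.sum_fintype _ _ (by simp)]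
    simp [Fin.sum_univ_four]
    zify
    linarith
  have := congrArg (eval x) h.sum_weight_X_mul_pderiv
  simp [Fin.sum_univ_four] at this
  linear_combination this

/-- Outside the exceptional set means: neither `x₁ = x₃ = 0` nor `x₂ = x₄ = 0`. -/
theorem exists_maximalCone_iff (x : Fin 4 → ℂ) :
    (∃ σ ∈ maximalCones, ∀ i, i ∉ σ → x i ≠ 0) ↔
      (x 0 ≠ 0 ∨ x 2 ≠ 0) ∧ (x 1 ≠ 0 ∨ x 3 ≠ 0) := by
  simp only [maximalCones, Set.mem_insert_iff, Set.mem_singleton_iff, exists_eq_or_imp,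
    exists_eq_left, Fin.forall_fin_succ]
  simp
  tauto

/-- Nondegeneracy on all torus orbits at once: the logarithmic derivatives `xᵢ ∂f/∂xᵢ` have no
common zero on the surface. On the curve the Euler relations reduce this to `x₁ ∂f/∂x₁` and
`x₄ ∂f/∂x₄`. -/
theorem Nondegenerate.no_common_zero {r a b : ℕ} {f : CoxRing} (hf : f ∈ sections r (a, b))
    (hnd : Nondegenerate f) {x : Fin 4 → ℂ} (hx : (x 0 ≠ 0 ∨ x 2 ≠ 0) ∧ (x 1 ≠ 0 ∨ x 3 ≠ 0))
    (h : eval x f = 0) (h0 : x 0 * eval x (pderiv 0 f) = 0)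
    (h3 : x 3 * eval x (pderiv 3 f) = 0) : False := by
  classical
  have hx' := (exists_maximalCone_iff x).2 hx
  have e1 := euler_fst hf x
  have e2 := euler_snd hf x
  rw [h, h0, h3] at e1
  rw [h, h3] at e2
  have hall : ∀ i, x i * eval x (pderiv i f) = 0 := by
    intro i
    fin_cases i
    · exact h0
    · simpa using e2
    · simpa using e1
    · exact h3
  obtain ⟨σ, hσ, hσx⟩ := id hx'
  obtain ⟨i, hi, hne⟩ := hnd.2 (Finset.univ.filter fun i => x i = 0)
    ⟨σ, hσ, fun i hi => by
      by_contra hc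
      exact hσx i hc (by simpa using hi)⟩ ⟨x, hx'⟩ (by simp) h
  have hxi : x i ≠ 0 := by simpa using hi
  exact hne ((mul_eq_zero.1 (hall i)).resolve_left hxi)

/-! ### Restriction to lines -/

/-- A prime not dividing `K` has a zero at which `K` does not vanish (Nullstellensatz). -/
theorem exists_zero_of_prime {P K : CoxRing} (hP : Prime P) (hK : ¬ P ∣ K) :
    ∃ z : Fin 4 → ℂ, eval z P = 0 ∧ eval z K ≠ 0 := by
  by_contra! hc
  apply hK
  rw [← Ideal.mem_span_singleton]
  have : (Ideal.span {P}).IsPrime := (Ideal.span_singleton_prime hP.ne_zero).2 hP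
  rw [← IsPrime.vanishingIdeal_zeroLocus (K := ℂ) (Ideal.span {P}), zeroLocus_span]
  rw [mem_vanishingIdeal_iff]
  intro z hz
  have := hc z (by simpa [aeval_eq_eval] using hz)
  simpa [aeval_eq_eval] using this

/-- Restriction of a polynomial to the line through `z` in the direction of the `i`-th axis. -/
noncomputable def restrictLine (z : Fin 4 → ℂ) (i : Fin 4) : CoxRing →ₐ[ℂ] Polynomial ℂ :=
  aeval (Function.update (fun j => Polynomial.C (z j)) i Polynomial.X)

theorem eval_restrictLine (z : Fin 4 → ℂ) (i : Fin 4) (g : CoxRing) (t : ℂ) :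
    (restrictLine z i g).eval t = eval (Function.update z i t) g := by
  have : ((Polynomial.aeval t).comp (restrictLine z i)) = aeval (Function.update z i t) := by
    apply MvPolynomial.algHom_ext
    intro j
    by_cases h : j = i
    · subst h; simp [restrictLine]
    · simp [restrictLine, h]
  have := AlgHom.congr_fun this g
  simpa [aeval_eq_eval, Polynomial.aeval_def, Polynomial.eval₂_eq_eval_map] using this

theorem derivative_restrictLine (z : Fin 4 → ℂ) (i : Fin 4) (g : CoxRing) :
    Polynomial.derivative (restrictLine z i g) = restrictLine z i (pderiv i g) := by
  induction g using MvPolynomial.induction_on with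
  | C c => simp [restrictLine]
  | add p q hp hq => simp [hp, hq]
  | mul_X p j hp =>
    by_cases h : j = i
    · subst h
      simp [hp, Derivation.leibniz]
      simp [restrictLine]; ring
    · simp [hp, Derivation.leibniz, pderiv_X_of_ne h]
      simp [restrictLine, h]; ring

/-- If `P` divides `∂P/∂xᵢ`, then `P` is constant along every line parallel to the `i`-th axis. -/
theorem restrictLine_eq_zero {P : CoxRing} {i : Fin 4} (h : P ∣ pderiv i P) {z : Fin 4 → ℂ}
    (hz : eval z P = 0) : restrictLine z i P = 0 := by
  have h1 : restrictLine z i P ∣ Polynomial.derivative (restrictLine z i P) := by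
    rw [derivative_restrictLine]
    exact map_dvd _ h
  rw [Polynomial.dvd_derivative_iff] at h1
  have h2 := Polynomial.eq_C_of_derivative_eq_zero h1
  have h3 : (restrictLine z i P).eval (z i) = 0 := by
    rw [eval_restrictLine, Function.update_eq_self, hz]
  rw [h2, Polynomial.eval_C] at h3
  rw [h2, h3, Polynomial.C_0]

/-- The value at infinity of a binary form of degree `n > 0`, given as `p` in one affine chart and
as `k` in the other: if `p` is constant, the form vanishes at infinity. -/
theorem eq_zero_at_infinity {n : ℕ} (hn : 0 < n) {k : ℂ → ℂ} (hk : Continuous k)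
    {p : Polynomial ℂ} (hp : p.degree ≤ 0) (h : ∀ u : ℂ, u ≠ 0 → k u = u ^ n * p.eval u⁻¹) :
    k 0 = 0 := by
  rw [Polynomial.degree_le_zero_iff] at hp
  rw [hp] at h
  simp only [Polynomial.eval_C] at h
  have hcl : IsClosed {u : ℂ | k u = u ^ n * p.coeff 0} := isClosed_eq hk (by fun_prop)
  have : (0 : ℂ) ∈ {u : ℂ | k u = u ^ n * p.coeff 0} := by
    have hd := (dense_compl_singleton (0 : ℂ)).mono
      (show _ ⊆ {u : ℂ | k u = u ^ n * p.coeff 0} from fun u hu => h u hu)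
    rw [← hcl.closure_eq, hd.closure_eq]
    trivial
  simpa [hn.ne'] using this

theorem eval_scale_fst {r a b : ℕ} {g : CoxRing} (hg : g ∈ sections r (a, b)) {u : ℂ}
    (hu : u ≠ 0) (x : Fin 4 → ℂ) :
    eval ![u * x 0, x 1, u * x 2, u ^ r * x 3] g = u ^ a * eval x g := by
  have h := eval_torus hg (Units.mk0 u hu) 1 x
  have hx : (fun i => (torusElement r (Units.mk0 u hu) 1 i : ℂ) * x i) =
      ![u * x 0, x 1, u * x 2, u ^ r * x 3] := by
    funext i
    fin_cases i <;> simp [torusElement]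
  rw [hx] at h
  simpa using h

theorem eval_scale_snd {r a b : ℕ} {g : CoxRing} (hg : g ∈ sections r (a, b)) {u : ℂ}
    (hu : u ≠ 0) (x : Fin 4 → ℂ) :
    eval ![x 0, u * x 1, x 2, u * x 3] g = u ^ b * eval x g := by
  have h := eval_torus hg 1 (Units.mk0 u hu) x
  have hx : (fun i => (torusElement r 1 (Units.mk0 u hu) i : ℂ) * x i) =
      ![x 0, u * x 1, x 2, u * x 3] := by
    funext i
    fin_cases i <;> simp [torusElement]
  rw [hx] at h
  simpa using h

/-- A section whose restriction to the section curve `t ↦ (t, z₂, z₃, z₄)` of the ruling has no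
zero at finite distance vanishes at the point of this curve with `x₃ = 0`. -/
theorem eval_infinity_zero {r a b : ℕ} (ha : 0 < a) {g : CoxRing} (hg : g ∈ sections r (a, b))
    (z : Fin 4 → ℂ) (h : (restrictLine z 0 g).degree ≤ 0) :
    eval ![1, z 1, 0, 0 ^ r * z 3] g = 0 := by
  have hk : Continuous fun u : ℂ => eval ![1, z 1, u * z 2, u ^ r * z 3] g := by
    refine (MvPolynomial.continuous_eval g).comp (continuous_pi fun i => ?_)
    fin_cases i <;> simp <;> fun_prop
  have := eq_zero_at_infinity ha hk h fun u hu => by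
    rw [eval_restrictLine, ← eval_scale_fst hg hu]
    simp [hu]
  simpa using this

/-- The same along a fibre `t ↦ (z₁, z₂, z₃, t)` of the ruling, at its point with `x₂ = 0`. -/
theorem eval_infinity_three {r a b : ℕ} (hb : 0 < b) {g : CoxRing} (hg : g ∈ sections r (a, b))
    (z : Fin 4 → ℂ) (h : (restrictLine z 3 g).degree ≤ 0) :
    eval ![z 0, 0, z 2, 1] g = 0 := by
  have hk : Continuous fun u : ℂ => eval ![z 0, u * z 1, z 2, 1] g := by
    refine (MvPolynomial.continuous_eval g).comp (continuous_pi fun i => ?_)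
    fin_cases i <;> simp <;> fun_prop
  have := eq_zero_at_infinity hb hk h fun u hu => by
    rw [eval_restrictLine, ← eval_scale_snd hg hu]
    simp [hu]
  simpa using this

/-! ### Coprimality of the section with its partial derivatives -/

variable {r a b : ℕ} {f : CoxRing}

/-- A nondegenerate section vanishes at no torus fixed point, hence no variable divides it. -/
theorem Nondegenerate.not_X_dvd (hf : f ∈ sections r (a, b)) (hnd : Nondegenerate f)
    (i : Fin 4) : ¬ X i ∣ f := by
  rintro ⟨g, hg⟩
  have hv : ∀ x : Fin 4 → ℂ, x i = 0 → eval x f = 0 := fun x hx => by simp [hg, hx]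
  fin_cases i
  · exact hnd.no_common_zero hf (x := ![0, 1, 1, 0]) (by simp) (hv _ rfl) (by simp) (by simp)
  · have h := euler_snd hf ![0, 0, 1, 1]
    rw [hv _ rfl] at h
    exact hnd.no_common_zero hf (x := ![0, 0, 1, 1]) (by simp) (hv _ rfl) (by simp)
      (by simpa using h)
  · have h := euler_fst hf ![1, 1, 0, 0]
    rw [hv _ rfl] at h
    exact hnd.no_common_zero hf (x := ![1, 1, 0, 0]) (by simp) (hv _ rfl)
      (by simpa using h) (by simp)
  · exact hnd.no_common_zero hf (x := ![0, 1, 1, 0]) (by simp) (hv _ rfl) (by simp) (by simp)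

/-- A common prime factor of `f` and `∂f/∂xᵢ` forces `f` and `∂f/∂xᵢ` to vanish along a line
parallel to the `i`-th axis: the factor cannot be multiple by nondegeneracy, hence divides its own
partial derivative. -/
theorem exists_line_of_prime_dvd (hf : f ∈ sections r (a, b))
    (hnd : Nondegenerate f) {P : CoxRing} (hP : Prime P)
    (hPf : P ∣ f) {i : Fin 4} (hPi : P ∣ pderiv i f) :
    ∃ z : Fin 4 → ℂ, (∀ j, z j ≠ 0) ∧ restrictLine z i f = 0 ∧
      restrictLine z i (pderiv i f) = 0 := by
  have hPX : ∀ j : Fin 4, ¬ P ∣ X j := fun j hj =>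
    hnd.not_X_dvd hf j (((hP.dvd_prime_iff_associated (X_prime (i := j))).1 hj).symm.dvd.trans hPf)
  obtain ⟨z, hz, hzX⟩ := exists_zero_of_prime hP (K := ∏ j, X j) (fun h => by
    obtain ⟨j, -, hj⟩ := (hP.dvd_finsetProd_iff _).1 h
    exact hPX j hj)
  have hz' : ∀ j, z j ≠ 0 := by
    simpa [Finset.prod_ne_zero_iff] using hzX
  refine ⟨z, hz', ?_⟩
  obtain ⟨Q, rfl⟩ := hPf
  have hPQ : ¬ P ∣ Q := by
    rintro ⟨R, rfl⟩
    exact hnd.no_common_zero hf ⟨Or.inl (hz' 0), Or.inl (hz' 1)⟩ (by simp [hz])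
      (by simp [Derivation.leibniz, hz]) (by simp [Derivation.leibniz, hz])
  have hPP : P ∣ pderiv i P := by
    rw [pderiv_mul, dvd_add_left (dvd_mul_right _ _)] at hPi
    exact (hP.dvd_or_dvd hPi).resolve_right hPQ
  have hline := restrictLine_eq_zero hPP hz
  refine ⟨by rw [map_mul, hline, zero_mul], ?_⟩
  obtain ⟨K, hK⟩ := hPi
  rw [hK, map_mul, hline, zero_mul]

theorem exists_isRoot_of_not_degree_le {p : Polynomial ℂ} (h : ¬ p.degree ≤ 0) :
    ∃ t, p.eval t = 0 :=
  Complex.exists_root (not_le.1 h)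

/-- A factor of `f` along which `∂f/∂x₄` vanishes would be a fibre of the ruling contained in the
curve; the remaining logarithmic derivative `x₁ ∂f/∂x₁` has degree `b > 0` on it, hence a zero. -/
theorem isRelPrime_pderiv_three (hb : 0 < b) (hf : f ∈ sections r (a, b))
    (hnd : Nondegenerate f) : IsRelPrime f (pderiv 3 f) := by
  rw [UniqueFactorizationMonoid.isRelPrime_iff_no_prime_factors hnd.1]
  intro P hPf hPi hP
  obtain ⟨z, hz, hline, hline'⟩ := exists_line_of_prime_dvd hf hnd hP hPf hPi
  have h3 : restrictLine z 3 (X 3 * pderiv 3 f) = 0 := by rw [map_mul, hline', mul_zero]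
  by_cases hdeg : (restrictLine z 3 (X 0 * pderiv 0 f)).degree ≤ 0
  · have h0 := eval_infinity_three hb (X_mul_pderiv_mem_sections hf 0) z hdeg
    have h1 := eval_infinity_three hb hf z (by simp [hline])
    have h2 := eval_infinity_three hb (X_mul_pderiv_mem_sections hf 3) z (by simp [h3])
    rw [map_mul, eval_X] at h0 h2
    exact hnd.no_common_zero hf (by simp [hz]) h1 h0 h2
  · obtain ⟨t, ht⟩ := exists_isRoot_of_not_degree_le hdeg
    rw [eval_restrictLine, map_mul, eval_X] at ht
    have h1 := eval_restrictLine z 3 f t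
    have h2 := eval_restrictLine z 3 (X 3 * pderiv 3 f) t
    rw [hline, Polynomial.eval_zero] at h1
    rw [h3, Polynomial.eval_zero, map_mul, eval_X] at h2
    exact hnd.no_common_zero hf (by simp [hz]) h1.symm ht h2.symm

/-- A factor of `f` along which `∂f/∂x₁` vanishes would be a section of the ruling disjoint from
`x₂ = 0`; the remaining logarithmic derivative `x₄ ∂f/∂x₄` has degree `a > 0` on it, hence a
zero. -/
theorem isRelPrime_pderiv_zero (ha : 0 < a) (hf : f ∈ sections r (a, b))
    (hnd : Nondegenerate f) : IsRelPrime f (pderiv 0 f) := by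
  rw [UniqueFactorizationMonoid.isRelPrime_iff_no_prime_factors hnd.1]
  intro P hPf hPi hP
  obtain ⟨z, hz, hline, hline'⟩ := exists_line_of_prime_dvd hf hnd hP hPf hPi
  have h3 : restrictLine z 0 (X 0 * pderiv 0 f) = 0 := by rw [map_mul, hline', mul_zero]
  by_cases hdeg : (restrictLine z 0 (X 3 * pderiv 3 f)).degree ≤ 0
  · have h0 := eval_infinity_zero ha (X_mul_pderiv_mem_sections hf 3) z hdeg
    have h1 := eval_infinity_zero ha hf z (by simp [hline])
    have h2 := eval_infinity_zero ha (X_mul_pderiv_mem_sections hf 0) z (by simp [h3])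
    rw [map_mul, eval_X] at h0 h2
    exact hnd.no_common_zero hf (by simp [hz]) h1 h2 h0
  · obtain ⟨t, ht⟩ := exists_isRoot_of_not_degree_le hdeg
    rw [eval_restrictLine, map_mul, eval_X] at ht
    have h1 := eval_restrictLine z 0 f t
    have h2 := eval_restrictLine z 0 (X 0 * pderiv 0 f) t
    rw [hline, Polynomial.eval_zero] at h1
    rw [h3, Polynomial.eval_zero, map_mul, eval_X] at h2
    exact hnd.no_common_zero hf (by simp [hz]) h1.symm h2.symm ht

theorem isRelPrime_X (hf : f ∈ sections r (a, b)) (hnd : Nondegenerate f) (i : Fin 4) :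
    IsRelPrime f (X i) :=
  ((X_prime (i := i)).irreducible.isRelPrime_iff_not_dvd.2 (hnd.not_X_dvd hf i)).symm

/-- A form coprime to `f` may be cancelled from a form that vanishes on the curve. -/
theorem eval_eq_zero_of_isRelPrime {H G : CoxRing} (hH : IsRelPrime f H)
    (h : ∀ x : Fin 4 → ℂ, (x 0 ≠ 0 ∨ x 2 ≠ 0) ∧ (x 1 ≠ 0 ∨ x 3 ≠ 0) → eval x f = 0 →
      eval x (H * G) = 0)
    {x : Fin 4 → ℂ} (hx : (x 0 ≠ 0 ∨ x 2 ≠ 0) ∧ (x 1 ≠ 0 ∨ x 3 ≠ 0)) (hfx : eval x f = 0) :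
    eval x G = 0 := by
  -- Multiplication by `B`, one of `x₁x₂, x₂x₃, x₃x₄, x₄x₁`, makes the product vanish on the
  -- whole affine hypersurface.
  have key : ∀ B : CoxRing, (∀ y : Fin 4 → ℂ, eval y B ≠ 0 →
      (y 0 ≠ 0 ∨ y 2 ≠ 0) ∧ (y 1 ≠ 0 ∨ y 3 ≠ 0)) → eval x B ≠ 0 → eval x G = 0 := by
    intro B hB hBx
    have hrad : H * (B * G) ∈ (Ideal.span {f}).radical := by
      rw [← vanishingIdeal_zeroLocus_eq_radical (K := ℂ), zeroLocus_span,
        mem_vanishingIdeal_iff]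
      intro y hy
      have hfy : eval y f = 0 := by simpa [aeval_eq_eval] using hy
      by_cases hBy : eval y B = 0
      · simp [aeval_eq_eval, hBy]
      · have := h y (hB y hBy) hfy
        rw [map_mul] at this
        rcases mul_eq_zero.1 this with h' | h' <;> simp [aeval_eq_eval, h']
    obtain ⟨n, hn⟩ := hrad
    rw [Ideal.mem_span_singleton, mul_pow] at hn
    obtain ⟨K, hK⟩ := (hH.pow_right (n := n)).dvd_of_dvd_mul_left hn
    have := congrArg (eval x) hK
    simp only [map_mul, map_pow, hfx, zero_mul] at this
    exact (mul_eq_zero.1 (eq_zero_of_pow_eq_zero this)).resolve_left hBx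
  rcases hx with ⟨h1 | h1, h2 | h2⟩
  · exact key (X 0 * X 1) (by simp; tauto) (by simp [h1, h2])
  · exact key (X 0 * X 3) (by simp; tauto) (by simp [h1, h2])
  · exact key (X 2 * X 1) (by simp; tauto) (by simp [h1, h2])
  · exact key (X 2 * X 3) (by simp; tauto) (by simp [h1, h2])

end Hirzebruch

/-! ### Fractions and morphisms -/

namespace FractionSpace

/-- A map that pulls basic fractions back to basic fractions is a morphism. -/
theorem isMorphism_of_fractions {X Y : Type*} [FractionSpace X] [FractionSpace Y] {φ : X → Y}
    (h : ∀ D q, (D, q) ∈ fractions (X := Y) → ∃ D' q', (D', q') ∈ fractions (X := X) ∧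
      D' = φ ⁻¹' D ∧ ∀ x ∈ D', q' x = q (φ x)) : IsMorphism φ := by
  constructor
  · refine continuous_generateFrom_iff.2 fun D ⟨q, hq⟩ => ?_
    obtain ⟨D', q', hq', hD', -⟩ := h D q hq
    exact hD' ▸ TopologicalSpace.isOpen_generateFrom_of_mem ⟨q', hq'⟩
  · intro O u _ hu p hp
    obtain ⟨D, q, hq, hpD, hqx⟩ := hu (φ p) hp
    obtain ⟨D', q', hq', rfl, hqq⟩ := h D q hq
    refine ⟨_, q', hq', hpD, fun x hx => ?_⟩
    rw [hqq x hx.2]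
    exact hqx (φ x) hx

/-- Two forms of the same degree on a vector space define a fraction on its projective space. -/
theorem exists_projective_fraction {W : Type*} [AddCommGroup W] [Module ℂ W] {d : ℕ}
    {F G : MvPolynomial (Module.Dual ℂ W) ℂ} (hF : F.IsHomogeneous d) (hG : G.IsHomogeneous d) :
    ∃ D q, (D, q) ∈ fractions (X := Projectivization ℂ W) ∧ ∀ (w : W) (hw : w ≠ 0),
      (Projectivization.mk ℂ w hw ∈ D ↔ eval (fun l => l w) G ≠ 0) ∧
      q (Projectivization.mk ℂ w hw) = eval (fun l => l w) F / eval (fun l => l w) G := by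
  have scale : ∀ {E : MvPolynomial (Module.Dual ℂ W) ℂ}, E.IsHomogeneous d → ∀ (c : ℂ) (w : W),
      eval (fun l => l (c • w)) E = c ^ d * eval (fun l => l w) E := by
    intro E hE c w
    rw [eval_eq, eval_eq, Finset.mul_sum]
    refine Finset.sum_congr rfl fun m hm => ?_
    simp only [map_smul, smul_eq_mul, mul_pow, Finset.prod_mul_distrib]
    rw [Finset.prod_pow_eq_pow_sum, ← hE.degree_eq_sum_deg_support hm]
    ring
  have key : ∀ (w : W) (hw : w ≠ 0),
      (Projectivization.mk ℂ w hw ∈ {p : Projectivization ℂ W | eval (fun l => l p.rep) G ≠ 0} ↔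
        eval (fun l => l w) G ≠ 0) ∧
      eval (fun l => l (Projectivization.mk ℂ w hw).rep) F /
        eval (fun l => l (Projectivization.mk ℂ w hw).rep) G =
          eval (fun l => l w) F / eval (fun l => l w) G := by
    intro w hw
    obtain ⟨c, hc⟩ := Projectivization.exists_smul_eq_mk_rep ℂ w hw
    rw [Units.smul_def] at hc
    have hc0 : (c : ℂ) ^ d ≠ 0 := pow_ne_zero _ c.ne_zero
    rw [Set.mem_ofPred_eq, ← hc, scale hF, scale hG]
    exact ⟨by simp [hc0], mul_div_mul_left _ _ hc0⟩
  exact ⟨_, fun p => eval (fun l => l p.rep) F / eval (fun l => l p.rep) G,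
    ⟨d, F, G, hF, hG, key⟩, key⟩

end FractionSpace

namespace Hirzebruch

open FractionSpace

variable {r : ℕ} {f : CoxRing} {β : ℤ × ℤ}

/-- Two sections of the same class define a fraction on the surface. -/
theorem exists_surface_fraction {α : ℤ × ℤ} {F G : CoxRing} (hF : F ∈ sections r α)
    (hG : G ∈ sections r α) :
    ∃ D q, (D, q) ∈ fractions (X := Surface r) ∧ ∀ x : CoxPoint,
      (toSurface r x ∈ D ↔ eval x.1 G ≠ 0) ∧
      q (toSurface r x) = eval x.1 F / eval x.1 G := by
  have key : ∀ x : CoxPoint,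
      (toSurface r x ∈ {P : Surface r | eval (Quotient.out P).1 G ≠ 0} ↔ eval x.1 G ≠ 0) ∧
      eval (Quotient.out (toSurface r x)).1 F / eval (Quotient.out (toSurface r x)).1 G =
        eval x.1 F / eval x.1 G := by
    intro x
    have h1 : toSurface r x = toSurface r (Quotient.out (toSurface r x)) :=
      (Quotient.out_eq (toSurface r x)).symm
    obtain ⟨s, t, hst⟩ := Quotient.exact h1
    have h2 : (Quotient.out (toSurface r x)).1 = fun i => (torusElement r s t i : ℂ) * x.1 i :=
      funext hst
    have hu : ((s ^ α.1 * t ^ α.2 : ℂˣ) : ℂ) ≠ 0 := Units.ne_zero _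
    rw [Set.mem_ofPred_eq, h2, eval_torus hF, eval_torus hG]
    exact ⟨by rw [mul_ne_zero_iff]; exact ⟨fun h => h.2, fun h => ⟨hu, h⟩⟩,
      mul_div_mul_left _ _ hu⟩
  exact ⟨_, fun P => eval (Quotient.out P).1 F / eval (Quotient.out P).1 G,
    ⟨α, F, G, hF, hG, key⟩, key⟩

theorem Cone.eval_eq_zero (x : Cone r f) : eval x.1.1 f = 0 := x.2 x.1 rfl

/-! ### The induced map is a morphism -/

/-- A section in `J₁(f)_β` as a linear form on the dual of the restricted system. -/
noncomputable def linearForm (g : J₁piece r f β) :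
    Module.Dual ℂ (Module.Dual ℂ (restrictedSystem r f β)) :=
  Module.Dual.eval ℂ _ ⟨restrict r f g.1, Submodule.mem_map_of_mem g.2⟩

@[simp]
theorem linearForm_evalAt (g : J₁piece r f β) (x : Cone r f) :
    linearForm g (evalAt r f β x) = eval x.1.1 g.1 := rfl

instance : FiniteDimensional ℂ (J₁piece r f β) :=
  Submodule.finiteDimensional_of_le (inf_le_right : J₁piece r f β ≤ sections r β)

instance : FiniteDimensional ℂ (restrictedSystem r f β) := by
  unfold restrictedSystem
  infer_instance

/-- The restricted system is finite-dimensional, so every linear form on its dual is given by a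
section. -/
theorem linearForm_surjective : Function.Surjective (linearForm (r := r) (f := f) (β := β)) := by
  intro l
  obtain ⟨⟨s, g, hg, rfl⟩, rfl⟩ := (Module.evalEquiv ℂ (restrictedSystem r f β)).surjective l
  exact ⟨⟨g, hg⟩, rfl⟩

/-- Forms of degree `d` on the projective space pull back to sections of the class `d β`. -/
theorem exists_section_of_form {d : ℕ}
    {G : MvPolynomial (Module.Dual ℂ (Module.Dual ℂ (restrictedSystem r f β))) ℂ}
    (hG : G.IsHomogeneous d) :
    ∃ K ∈ sections r (d • β), ∀ x : Cone r f,
      eval (fun l => l (evalAt r f β x)) G = eval x.1.1 K := by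
  choose g hg using linearForm_surjective (r := r) (f := f) (β := β)
  refine ⟨aeval (fun l => (g l).1) G, ?_, fun x => ?_⟩
  · rw [aeval_def, eval₂_eq]
    refine Submodule.sum_mem _ fun m hm => ?_
    have hdeg : ∑ i ∈ m.support, m i = d := (hG.degree_eq_sum_deg_support hm).symm
    have h1 : (∏ i ∈ m.support, (g i).1 ^ m i : CoxRing) ∈
        sections r (∑ i ∈ m.support, m i • β) :=
      IsWeightedHomogeneous.prod _ _ _ fun i _ => IsWeightedHomogeneous.pow (g i).2.2 (m i)
    rw [← Finset.sum_smul, hdeg] at h1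
    exact IsWeightedHomogeneous.C_mul h1 _
  · have : (eval x.1.1).comp (aeval (fun l => (g l).1) : _ →ₐ[ℂ] CoxRing).toRingHom =
        eval (fun l => l (evalAt r f β x)) := by
      apply MvPolynomial.ringHom_ext
      · intro c; simp
      · intro l
        conv_rhs => rw [eval_X, ← hg l, linearForm_evalAt]
        simp
    exact (RingHom.congr_fun this G).symm

theorem toSurface_lift (P : curve r f) : toSurface r (lift P).1 = P.1 := Quotient.out_eq P.1

/-- The fractions on the projective space pull back to fractions on the curve. -/
theorem exists_pullback_fraction (h : BasePointFree r f β)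
    {D : Set (Projectivization ℂ (Module.Dual ℂ (restrictedSystem r f β)))}
    {q : Projectivization ℂ (Module.Dual ℂ (restrictedSystem r f β)) → ℂ}
    (hq : (D, q) ∈ fractions (X := Projectivization ℂ (Module.Dual ℂ (restrictedSystem r f β)))) :
    ∃ D' q', (D', q') ∈ fractions (X := curve r f) ∧ D' = inducedMap h ⁻¹' D ∧
      ∀ P, q' P = q (inducedMap h P) := by
  obtain ⟨d, F, G, hF, hG, hFG⟩ := hq
  obtain ⟨F', hF', hFx⟩ := exists_section_of_form hF
  obtain ⟨G', hG', hGx⟩ := exists_section_of_form hG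
  obtain ⟨D', q', hq', hx⟩ := exists_surface_fraction hF' hG'
  refine ⟨_, _, ⟨D', q', hq', rfl⟩, ?_, fun P => ?_⟩
  · ext P
    rw [Set.mem_preimage, Set.mem_preimage, inducedMap, (hFG _ _).1, hGx, ← (hx _).1,
      toSurface_lift]
  · exact (congrArg q' (toSurface_lift P)).symm.trans
      (((hx _).2.trans (by rw [hFx, hGx])).trans (hFG _ _).2.symm)

theorem isMorphism_inducedMap (h : BasePointFree r f β) : IsMorphism (inducedMap h) :=
  isMorphism_of_fractions fun _ _ hq =>
    let ⟨D', q', hq', hD, hqq⟩ := exists_pullback_fraction h hq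
    ⟨D', q', hq', hD, fun x _ => hqq x⟩

/-! ### Sections in the linear system -/

theorem mem_J₁_of_mul_eq {g K : CoxRing} {i : Fin 4}
    (h : g * ∏ j, (X j : CoxRing) = K * (X i * pderiv i f)) : g ∈ J₁ f := by
  rw [J₁, Submodule.mem_colon]
  intro p hp
  obtain ⟨c, rfl⟩ := Ideal.mem_span_singleton'.1 hp
  have : g • (c * ∏ j, (X j : CoxRing)) = c * K * (X i * pderiv i f) := by
    rw [smul_eq_mul]; linear_combination c * h
  rw [this]
  exact Ideal.mul_mem_left _ _ (Ideal.subset_span ⟨i, rfl⟩)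

theorem X_mul_pderiv_mem_J₁piece (hf : f ∈ sections r β) (i : Fin 4) :
    X i * pderiv i f ∈ J₁piece r f β :=
  ⟨mem_J₁_of_mul_eq (K := ∏ j, X j) (mul_comm _ _), X_mul_pderiv_mem_sections hf i⟩

theorem X_two_mul_pderiv_zero_mem_J₁piece (hf : f ∈ sections r β) :
    X 2 * pderiv 0 f ∈ J₁piece r f β := by
  refine ⟨mem_J₁_of_mul_eq (i := 0) (K := X 1 * X 2 ^ 2 * X 3) ?_, ?_⟩
  · rw [Fin.prod_univ_four]; ring
  · have := mul_mem_sections (X_mem_sections r 2) (pderiv_mem_sections hf 0)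
    have e : coxDegree r 2 + (β - coxDegree r 0) = β := add_sub_cancel _ _
    rwa [e] at this

theorem X_mul_pow_mul_pderiv_three_mem_J₁piece (hf : f ∈ sections r β) :
    X 1 * X 2 ^ r * pderiv 3 f ∈ J₁piece r f β := by
  refine ⟨mem_J₁_of_mul_eq (i := 3) (K := X 0 * X 1 ^ 2 * X 2 ^ (r + 1)) ?_, ?_⟩
  · rw [Fin.prod_univ_four]; ring
  · have h1 : (X 1 * X 2 ^ r : CoxRing) ∈ sections r (coxDegree r 1 + r • coxDegree r 2) :=
      mul_mem_sections (X_mem_sections r 1) (IsWeightedHomogeneous.pow (X_mem_sections r 2) r)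
    have h2 := mul_mem_sections h1 (pderiv_mem_sections hf 3)
    have e : coxDegree r 1 + r • coxDegree r 2 + (β - coxDegree r 3) = β := by
      ext <;> simp [coxDegree]
    rwa [e] at h2

theorem basePointFree {a b : ℕ} (hf : f ∈ sections r (a, b)) (hnd : Nondegenerate f) :
    BasePointFree r f (a, b) := by
  intro x
  by_contra! hc
  have hv : ∀ i, eval x.1.1 (X i * pderiv i f) = 0 := fun i =>
    hc _ (Submodule.mem_map_of_mem (X_mul_pderiv_mem_J₁piece hf i))
  have h0 := hv 0
  have h3 := hv 3
  rw [map_mul, eval_X] at h0 h3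
  exact hnd.no_common_zero hf ((exists_maximalCone_iff _).1 x.1.2) x.eval_eq_zero h0 h3

end Hirzebruch

namespace Hirzebruch

open FractionSpace

/-! ### The inverse map -/

/-- The numerator of `F(A / B, 1, 1, C / D)` over the denominator `(B D)ᴺ`, as a polynomial in the
four variables `A, B, C, D`. The exponents `N - d 0` and `N - d 3` are not truncated when `N` is at
least the total degree of `F`. -/
noncomputable def homogenization {κ : Type*} (A B C' D : κ) (N : ℕ) (F : CoxRing) :
    MvPolynomial κ ℂ :=
  ∑ d ∈ F.support, C (coeff d F) * (X A ^ d 0 * X B ^ (N - d 0) * (X C' ^ d 3 * X D ^ (N - d 3)))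

theorem le_totalDegree_of_mem_support {F : CoxRing} {d : Fin 4 →₀ ℕ} (hd : d ∈ F.support)
    (i : Fin 4) : d i ≤ F.totalDegree :=
  (monomial_le_degreeOf i hd).trans (degreeOf_le_totalDegree F i)

theorem homogenization_isHomogeneous {κ : Type*} (A B C' D : κ) {N : ℕ} {F : CoxRing}
    (hN : F.totalDegree ≤ N) : (homogenization A B C' D N F).IsHomogeneous (N + N) := by
  refine IsHomogeneous.sum _ _ _ fun d hd => ?_
  have h0 := (le_totalDegree_of_mem_support hd 0).trans hN
  have h3 := (le_totalDegree_of_mem_support hd 3).trans hN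
  have := (((isHomogeneous_X_pow (R := ℂ) A (d 0)).mul (isHomogeneous_X_pow B (N - d 0))).mul
    ((isHomogeneous_X_pow C' (d 3)).mul (isHomogeneous_X_pow D (N - d 3)))).C_mul (coeff d F)
  rwa [Nat.add_sub_cancel' h0, Nat.add_sub_cancel' h3] at this

theorem eval_homogenization {κ : Type*} (A B C' D : κ) {N : ℕ} {F : CoxRing}
    (hN : F.totalDegree ≤ N) {v : κ → ℂ} (hB : v B ≠ 0) (hD : v D ≠ 0) :
    eval v (homogenization A B C' D N F) =
      (v B ^ N * v D ^ N) * eval ![v A / v B, 1, 1, v C' / v D] F := by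
  rw [homogenization, map_sum, eval_eq', Finset.mul_sum]
  refine Finset.sum_congr rfl fun d hd => ?_
  have h0 := (le_totalDegree_of_mem_support hd 0).trans hN
  have h3 := (le_totalDegree_of_mem_support hd 3).trans hN
  simp [Fin.prod_univ_four]
  rw [pow_sub₀ _ hB h0, pow_sub₀ _ hD h3, div_pow, div_pow]
  field_simp

variable {r : ℕ} {f : CoxRing} {β : ℤ × ℤ}

/-- A point with `x₂ ≠ 0` and `x₃ ≠ 0` has homogeneous coordinates with `x₂ = x₃ = 1`. -/
theorem exists_normalized (x : CoxPoint) (h1 : x.1 1 ≠ 0) (h2 : x.1 2 ≠ 0) :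
    ∃ y : CoxPoint, y.1 = ![x.1 0 / x.1 2, 1, 1, x.1 3 / (x.1 1 * x.1 2 ^ r)] ∧
      toSurface r y = toSurface r x := by
  let y : CoxPoint := ⟨![x.1 0 / x.1 2, 1, 1, x.1 3 / (x.1 1 * x.1 2 ^ r)],
    (exists_maximalCone_iff _).2 (by simp)⟩
  refine ⟨y, rfl,
    (Quotient.sound ⟨(Units.mk0 _ h2)⁻¹, (Units.mk0 _ h1)⁻¹, fun i => ?_⟩ : toSurface r x = _).symm⟩
  fin_cases i <;> simp [torusElement, h1, h2, y] <;> field_simp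

/-! ### Density -/

theorem eval_ne_zero_iff_of_toSurface_eq {α : ℤ × ℤ} {G : CoxRing} (hG : G ∈ sections r α)
    {x y : CoxPoint} (h : toSurface r x = toSurface r y) : eval x.1 G ≠ 0 ↔ eval y.1 G ≠ 0 := by
  obtain ⟨D, q, -, hD⟩ := exists_surface_fraction hG hG
  rw [← (hD x).1, h, (hD y).1]

theorem mem_curve_toSurface (hf : f ∈ sections r β) {x : CoxPoint} (hx : eval x.1 f = 0) :
    toSurface r x ∈ curve r f := fun _ hy =>
  not_not.1 (mt (eval_ne_zero_iff_of_toSurface_eq hf hy).1 (not_not.2 hx))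

/-- The basic open sets of the curve are the loci `G ≠ 0`, for sections `G` of any class. -/
theorem isBasic_curve_iff {D : Set (curve r f)} :
    (∃ q, (D, q) ∈ fractions (X := curve r f)) ↔
      ∃ α, ∃ G ∈ sections r α, D = {P | eval (lift P).1.1 G ≠ 0} := by
  constructor
  · rintro ⟨_, D', q', ⟨α, F, G, -, hG, hFG⟩, he⟩
    refine ⟨α, G, hG, ?_⟩
    rw [(Prod.mk.inj he).1]
    ext P
    rw [Set.mem_preimage, ← toSurface_lift P]
    exact (hFG _).1
  · rintro ⟨α, G, hG, rfl⟩
    obtain ⟨D, q, hq, hD⟩ := exists_surface_fraction hG hG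
    refine ⟨_, D, q, hq, Prod.ext ?_ rfl⟩
    ext P
    rw [Set.mem_preimage, ← toSurface_lift P]
    exact (hD _).1.symm

theorem isTopologicalBasis_curve :
    @TopologicalSpace.IsTopologicalBasis (curve r f) (zariski (curve r f))
      {D | ∃ q, (D, q) ∈ fractions (X := curve r f)} := by
  let := zariski (curve r f)
  refine ⟨?_, ?_, rfl⟩
  · intro s hs t ht P hP
    obtain ⟨α, G, hG, rfl⟩ := isBasic_curve_iff.1 hs
    obtain ⟨γ, K, hK, rfl⟩ := isBasic_curve_iff.1 ht
    refine ⟨_, isBasic_curve_iff.2 ⟨_, _, mul_mem_sections hG hK, rfl⟩, ?_, ?_⟩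
    · simpa using hP
    · intro Q hQ
      simpa using hQ
  · refine Set.eq_univ_of_forall fun P => ⟨_, isBasic_curve_iff.2
      ⟨0, 1, isWeightedHomogeneous_one ℂ _, rfl⟩, ?_⟩
    simp

/-- The locus on the curve where a form coprime to `f` does not vanish is dense. -/
theorem dense_of_isRelPrime (hf : f ∈ sections r β) {γ : ℤ × ℤ} {H : CoxRing}
    (hH : H ∈ sections r γ) (hfH : IsRelPrime f H) :
    @Dense (curve r f) (zariski (curve r f)) {P | eval (lift P).1.1 H ≠ 0} := by
  let := zariski (curve r f)
  rw [isTopologicalBasis_curve.dense_iff]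
  rintro o ho ⟨P, hP⟩
  obtain ⟨α, G, hG, rfl⟩ := isBasic_curve_iff.1 ho
  by_contra hne
  refine hP (eval_eq_zero_of_isRelPrime hfH (fun x hx hfx => ?_)
    ((exists_maximalCone_iff _).1 (lift P).1.2) (lift P).eval_eq_zero)
  by_contra hHG
  let x' : CoxPoint := ⟨x, (exists_maximalCone_iff x).2 hx⟩
  let Q : curve r f := ⟨toSurface r x', mem_curve_toSurface hf hfx⟩
  have h1 : eval (lift Q).1.1 (H * G) ≠ 0 :=
    (eval_ne_zero_iff_of_toSurface_eq (mul_mem_sections hH hG) (toSurface_lift Q)).2 hHG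
  rw [map_mul, mul_ne_zero_iff] at h1
  exact hne ⟨Q, h1.2, h1.1⟩

/-! ### Birationality -/

section Birational

variable (hf : f ∈ sections r β)

/-- The sections `x₁ ∂f/∂x₁`, `x₃ ∂f/∂x₁`, `x₄ ∂f/∂x₄`, `x₂ x₃ʳ ∂f/∂x₄` of the linear system.
Their ratios recover the affine coordinates `x₁/x₃` and `x₄/(x₂x₃ʳ)`. -/
noncomputable def coordinateSections : Fin 4 → J₁piece r f β :=
  ![⟨_, X_mul_pderiv_mem_J₁piece hf 0⟩, ⟨_, X_two_mul_pderiv_zero_mem_J₁piece hf⟩,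
    ⟨_, X_mul_pderiv_mem_J₁piece hf 3⟩, ⟨_, X_mul_pow_mul_pderiv_three_mem_J₁piece hf⟩]

/-- The product of the two sections occurring as denominators of the affine coordinates. -/
noncomputable def denominator : CoxRing :=
  (coordinateSections hf 1).1 * (coordinateSections hf 3).1

theorem denominator_mem_sections : denominator hf ∈ sections r (β + β) :=
  mul_mem_sections (coordinateSections hf 1).2.2 (coordinateSections hf 3).2.2

/-- Away from the zeros of the denominator, the values of the coordinate sections determine
homogeneous coordinates of the point. -/
theorem exists_coordinates {x : CoxPoint} (hx : eval x.1 (denominator hf) ≠ 0) :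
    ∃ y : CoxPoint, toSurface r y = toSurface r x ∧
      y.1 = ![eval x.1 (coordinateSections hf 0).1 / eval x.1 (coordinateSections hf 1).1, 1, 1,
        eval x.1 (coordinateSections hf 2).1 / eval x.1 (coordinateSections hf 3).1] := by
  simp only [denominator, coordinateSections, Matrix.cons_val, map_mul, map_pow, eval_X,
    mul_ne_zero_iff] at hx ⊢
  obtain ⟨⟨h2, h0⟩, ⟨h1, h2r⟩, h3⟩ := hx
  obtain ⟨y, hy, hyx⟩ := exists_normalized (r := r) x h1 h2
  refine ⟨y, hyx, hy.trans ?_⟩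
  rw [mul_div_mul_right _ _ h0, mul_div_mul_right _ _ h3]

/-- The inverse of the induced map is given by fractions: a fraction of Cox polynomials, expressed
in the affine coordinates `x₁/x₃` and `x₄/(x₂x₃ʳ)`, is a fraction of forms in the coordinate
sections. -/
theorem exists_inverse_fraction (h : BasePointFree r f β) {D : Set (Surface r)}
    {q : Surface r → ℂ} (hq : (D, q) ∈ fractions (X := Surface r)) :
    ∃ D' q', (D', q') ∈
        fractions (X := Projectivization ℂ (Module.Dual ℂ (restrictedSystem r f β))) ∧
      ∀ P : curve r f, eval (lift P).1.1 (denominator hf) ≠ 0 →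
        (inducedMap h P ∈ D' ↔ P.1 ∈ D) ∧ q' (inducedMap h P) = q P.1 := by
  obtain ⟨α, F, G, -, -, hFG⟩ := hq
  let l : Fin 4 → Module.Dual ℂ (Module.Dual ℂ (restrictedSystem r f β)) :=
    fun i => linearForm (coordinateSections hf i)
  let N := max F.totalDegree G.totalDegree
  obtain ⟨D', q', hq', hD'⟩ := exists_projective_fraction
    (homogenization_isHomogeneous (l 0) (l 1) (l 2) (l 3) (le_max_left _ _ : F.totalDegree ≤ N))
    (homogenization_isHomogeneous (l 0) (l 1) (l 2) (l 3) (le_max_right _ _ : G.totalDegree ≤ N))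
  refine ⟨D', q', hq', fun P hP => ?_⟩
  obtain ⟨y, hyP, hy⟩ := exists_coordinates hf hP
  rw [toSurface_lift] at hyP
  rw [denominator, map_mul, mul_ne_zero_iff] at hP
  obtain ⟨h1, h3⟩ := hP
  have hv : ∀ E : CoxRing, E.totalDegree ≤ N →
      eval (fun l => l (evalAt r f β (lift P))) (homogenization (l 0) (l 1) (l 2) (l 3) N E) =
        (eval (lift P).1.1 (coordinateSections hf 1).1 ^ N *
          eval (lift P).1.1 (coordinateSections hf 3).1 ^ N) * eval y.1 E := by
    intro E hE
    rw [hy]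
    exact eval_homogenization (l 0) (l 1) (l 2) (l 3) hE (v := fun l => l (evalAt r f β (lift P)))
      h1 h3
  have hne : eval (lift P).1.1 (coordinateSections hf 1).1 ^ N *
      eval (lift P).1.1 (coordinateSections hf 3).1 ^ N ≠ 0 :=
    mul_ne_zero (pow_ne_zero _ h1) (pow_ne_zero _ h3)
  rw [← hyP]
  constructor
  · rw [inducedMap, (hD' _ _).1, hv _ (le_max_right _ _), mul_ne_zero_iff]
    exact ⟨fun h => (hFG y).1.2 h.2, fun h => ⟨hne, (hFG y).1.1 h⟩⟩
  · rw [inducedMap, (hD' _ _).2, hv _ (le_max_right _ _), hv _ (le_max_left _ _),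
      mul_div_mul_left _ _ hne]
    exact (hFG y).2.symm

/-- The locus on the projective space where the two denominators do not vanish. -/
theorem exists_chart (h : BasePointFree r f β) :
    ∃ D q, (D, q) ∈ fractions (X := Projectivization ℂ (Module.Dual ℂ (restrictedSystem r f β))) ∧
      ∀ P : curve r f, inducedMap h P ∈ D ↔ eval (lift P).1.1 (denominator hf) ≠ 0 := by
  have hG := (isHomogeneous_X ℂ (linearForm (coordinateSections hf 1))).mul
    (isHomogeneous_X ℂ (linearForm (coordinateSections hf 3)))
  obtain ⟨D, q, hq, hD⟩ := exists_projective_fraction hG hG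
  refine ⟨D, q, hq, fun P => ?_⟩
  rw [inducedMap, (hD _ _).1]
  simp [denominator]

/-- Where the denominator does not vanish, the induced map is injective. -/
theorem eq_of_inducedMap_eq (h : BasePointFree r f β) {P Q : curve r f}
    (hP : eval (lift P).1.1 (denominator hf) ≠ 0) (hQ : eval (lift Q).1.1 (denominator hf) ≠ 0)
    (hPQ : inducedMap h P = inducedMap h Q) : P = Q := by
  obtain ⟨y, hyP, hy⟩ := exists_coordinates hf hP
  obtain ⟨z, hzQ, hz⟩ := exists_coordinates hf hQ
  obtain ⟨c, hc⟩ := (Projectivization.mk_eq_mk_iff ℂ _ _ _ _).1 hPQ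
  have hcs : ∀ g : J₁piece r f β, eval (lift P).1.1 g.1 = c * eval (lift Q).1.1 g.1 := fun g => by
    have := congrArg (linearForm g) hc
    rw [Units.smul_def, map_smul] at this
    exact this.symm
  have hyz : y = z := Subtype.ext <| by
    rw [hy, hz, hcs, hcs, hcs, hcs, mul_div_mul_left _ _ c.ne_zero, mul_div_mul_left _ _ c.ne_zero]
  apply Subtype.ext
  rw [← toSurface_lift P, ← toSurface_lift Q, ← hyP, ← hzQ, hyz]

/-- The induced map is birational onto its image as soon as the denominator is coprime to `f`. -/
theorem isBirationalOntoImage_inducedMap (h : BasePointFree r f β)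
    (hrel : IsRelPrime f (denominator hf)) : IsBirationalOntoImage (inducedMap h) := by
  obtain ⟨D, q, hq, hD⟩ := exists_chart hf h
  let U : Set (curve r f) := {P | eval (lift P).1.1 (denominator hf) ≠ 0}
  let V : Set (Set.range (inducedMap h)) := Subtype.val ⁻¹' D
  have hU : @Dense (curve r f) (zariski (curve r f)) U :=
    dense_of_isRelPrime hf (denominator_mem_sections hf) hrel
  let φ : U → V := fun P => ⟨⟨inducedMap h P.1, P.1, rfl⟩, (hD P.1).2 P.2⟩
  have hφ : Function.Bijective φ := by
    constructor
    · intro P Q hPQ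
      exact Subtype.ext (eq_of_inducedMap_eq hf h P.2 Q.2
        (congrArg (fun v : V => v.1.1) hPQ))
    · rintro ⟨⟨_, P, rfl⟩, hv⟩
      exact ⟨⟨P, (hD P).1 hv⟩, rfl⟩
  let e : U ≃ V := Equiv.ofBijective φ hφ
  refine ⟨U, V, ?_, hU, ?_, ?_, e, ?_, ?_, fun _ => rfl⟩
  · exact TopologicalSpace.isOpen_generateFrom_of_mem
      (isBasic_curve_iff.2 ⟨_, _, denominator_mem_sections hf, rfl⟩)
  · exact TopologicalSpace.isOpen_generateFrom_of_mem ⟨_, D, q, hq, rfl⟩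
  · let := zariski (curve r f)
    let := zariski (Set.range (inducedMap h))
    have hcont : Continuous (Set.rangeFactorization (inducedMap h)) :=
      (isMorphism_of_fractions (φ := Set.rangeFactorization (inducedMap h))
        fun _ _ hs => by
          obtain ⟨D₁, q₁, hq₁, he⟩ := hs
          obtain ⟨D', q', hq', hD', hqq⟩ := exists_pullback_fraction h hq₁
          obtain ⟨rfl, rfl⟩ := Prod.mk.inj he
          exact ⟨D', q', hq', hD', fun P _ => hqq P⟩).1
    refine (Set.rangeFactorization_surjective.denseRange.dense_image hcont hU).mono ?_
    rintro _ ⟨P, hP, rfl⟩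
    exact (hD P).2 hP
  · refine isMorphism_of_fractions fun _ _ ⟨D₁, q₁, ⟨D₂, q₂, hq₂, he₂⟩, he₁⟩ => ?_
    obtain ⟨rfl, rfl⟩ := Prod.mk.inj he₂
    obtain ⟨rfl, rfl⟩ := Prod.mk.inj he₁
    obtain ⟨D', q', hq', rfl, hqq⟩ := exists_pullback_fraction h hq₂
    exact ⟨_, _, ⟨_, q', hq', rfl⟩, rfl, fun P _ => hqq P.1⟩
  · refine isMorphism_of_fractions fun _ _ ⟨D₁, q₁, ⟨D₂, q₂, hq₂, he₂⟩, he₁⟩ => ?_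
    obtain ⟨rfl, rfl⟩ := Prod.mk.inj he₂
    obtain ⟨rfl, rfl⟩ := Prod.mk.inj he₁
    obtain ⟨D', q', hq', hP⟩ := exists_inverse_fraction hf h hq₂
    refine ⟨_, _, ⟨_, _, ⟨D', q', hq', rfl⟩, rfl⟩, ?_, ?_⟩
    · ext v
      obtain ⟨P, rfl⟩ := e.surjective v
      rw [Set.mem_preimage, Set.mem_preimage, Set.mem_preimage, e.symm_apply_apply]
      exact (hP P.1 P.2).1
    · intro v _
      obtain ⟨P, rfl⟩ := e.surjective v
      rw [e.symm_apply_apply]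
      exact (hP P.1 P.2).2

end Birational

end Hirzebruch

theorem mainTheorem6 (r : ℕ) (a b : ℤ) (hb : 0 < b) (hab : (r : ℤ) * b < a)
    (f : Hirzebruch.CoxRing) (hf : f ∈ Hirzebruch.sections r (a, b))
    (hnd : Hirzebruch.Nondegenerate f) :
    ∃ h : Hirzebruch.BasePointFree r f (a, b),
      FractionSpace.IsMorphism (Hirzebruch.inducedMap h) ∧
      FractionSpace.IsBirationalOntoImage (Hirzebruch.inducedMap h) := by
  have ha : 0 < a := lt_of_le_of_lt (by positivity) hab
  lift a to ℕ using ha.le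
  lift b to ℕ using hb.le
  refine ⟨Hirzebruch.basePointFree hf hnd, Hirzebruch.isMorphism_inducedMap _,
    Hirzebruch.isBirationalOntoImage_inducedMap hf _ ?_⟩
  have hX := Hirzebruch.isRelPrime_X hf hnd
  exact ((hX 2).mul_right (Hirzebruch.isRelPrime_pderiv_zero (mod_cast ha) hf hnd)).mul_right
    (((hX 1).mul_right (hX 2).pow_right).mul_right
      (Hirzebruch.isRelPrime_pderiv_three (mod_cast hb) hf hnd))
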